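/- Let $\mathcal H$ and $\mathcal K$ be complex separable Hilbert spaces, let $F\colon\mathcal H\to\mathcal K$ be a (possibly unbounded) closed operator with trivial kernel and dense range, let $\mathcal J$ be a real vector space of bounded self-adjoint operators on $\mathcal K$, and let $\mathcal A_0=\{F^*JF : J\in\mathcal J\}$. Let $A$ be an operator on $\mathcal H$ with domain $\mathcal D$ such that $\mathcal D\subset\operatorname{dom}F$, such that $\mathcal D\subset\operatorname{dom}V$ for every $V\in\mathcal A_0$, and such that every operator $A+V$ (with domain $\mathcal D$), $V\in\mathcal A_0$, is self-adjoint; put $\mathcal A=A+\mathcal A_0$. Assume that for all $H\in\mathcal A$ and $z\in\mathbb C\setminus\mathbb R$ the operator $F(H-z)^{-1}F^*$, defined on $\operatorname{dom}F^*$, is bounded and that its continuous extension $T_z(H)$ to $\mathcal K$ is compact. For $\lambda\in\mathbb R$, an operator $H\in\mathcal A$ is called regular at $\lambda$ if the limit $T_{\lambda+i0}(H)=\lim_{y\to0^+}T_{\lambda+iy}(H)$ exists in the operator norm, and resonant at $\lambda$ otherwise; $\lambda$ is called essentially regular if at least one operator in $\mathcal A$ is regular at $\lambda$. If $H\in\mathcal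 A$ is resonant at $\lambda$, then $V\in\mathcal A_0$ is called a regularizing direction for $H$ at $\lambda$ if $H+tV$ is regular at $\lambda$ for some $t\in\mathbb R$. If a line $H_s=H_0+sV$ ($s\in\mathbb R$, $H_0\in\mathcal A$, $V=F^*JF$, $J\in\mathcal J$) satisfies $H_{r_\lambda}=H$, and $H_s$ is regular at $\lambda$, the space of first-order resonance vectors is the space of solutions of the homogeneous Lippmann–Schwinger equation, $$\Upsilon^1_{\lambda+i0}(r_\lambda)=\{u\in\mathcal K : (1+(r_\lambda-s)\,T_{\lambda+i0}(H_s)J)\,u=0\}.$$ Theorem. Suppose that $\lambda$ is essentially regular and that $H\in\mathcal A$ is resonant at $\lambda$. Then the vector space $\Upsilon^1_{\lambda+i0}(r_\lambda)$ does not depend on the regularizing direction: if $V=F^*JF$ and $V'=F^*J'F$ (with $J,J'\in\mathcal J$) are regularizing directions for $H$ at $\lambda$, if $H_0,H_0'\in\mathcal A$ and $r_\lambda,r'_\lambda\in\mathbb R$ satisfy $H_0+r_\lambda V=H=H_0'+r_\lambda'V'$, and if $s,s'\in\mathbb R$ are such that $H_0+sV$ and $H_0'+s'V'$ are regular at $\lambda$,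 then $$\{u : (1+(r_\lambda-s)T_{\lambda+i0}(H_0+sV)J)u=0\}=\{u : (1+(r'_\lambda-s')T_{\lambda+i0}(H'_0+s'V')J')u=0\}.$$ -/

import Mathlib

open Filter Topology

noncomputable section

namespace SandwichedResolvent

section Composition

variable {X Y Z : Type*} [AddCommGroup X] [Module ℂ X] [AddCommGroup Y] [Module ℂ Y]
  [AddCommGroup Z] [Module ℂ Z]

/-- The composition `g f` of two partially defined operators, on its natural domain
`{x ∈ dom f | f x ∈ dom g}`. -/
def pcomp (g : Y →ₗ.[ℂ] Z) (f : X →ₗ.[ℂ] Y) : X →ₗ.[ℂ] Z where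
  domain := (g.domain.comap f.toFun).map f.domain.subtype
  toFun :=
    { toFun := fun x => g ⟨f ⟨x.1, by obtain ⟨a, -, ha⟩ := x.2; exact ha ▸ a.2⟩, by
        obtain ⟨_, a, ha, rfl⟩ := x; exact ha⟩
      map_add' := fun x y => by
        rw [← g.map_add]; congr 1; apply Subtype.ext
        exact f.map_add ⟨x.1, _⟩ ⟨y.1, _⟩
      map_smul' := fun c x => by
        rw [RingHom.id_apply, ← g.map_smul]; congr 1; apply Subtype.ext
        exact f.map_smul c ⟨x.1, _⟩ }

theorem mem_pcomp_domain (g : Y →ₗ.[ℂ] Z) (f : X →ₗ.[ℂ] Y) (x : X) :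
    x ∈ (pcomp g f).domain ↔ ∃ h : x ∈ f.domain, f ⟨x, h⟩ ∈ g.domain := by
  constructor
  · rintro ⟨a, ha, rfl⟩; exact ⟨a.2, ha⟩
  · rintro ⟨h, hx⟩; exact ⟨⟨x, h⟩, hx, rfl⟩

theorem pcomp_apply (g : Y →ₗ.[ℂ] Z) (f : X →ₗ.[ℂ] Y) {x : X} (hx : x ∈ (pcomp g f).domain)
    (h : x ∈ f.domain) (h' : f ⟨x, h⟩ ∈ g.domain) :
    pcomp g f ⟨x, hx⟩ = g ⟨f ⟨x, h⟩, h'⟩ := rfl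

/-- The resolvent `R_z(H) = (H - z)⁻¹` of an operator `H`. -/
def resolventOp (H : X →ₗ.[ℂ] X) (z : ℂ) : X →ₗ.[ℂ] X :=
  (H - (z • (LinearMap.id : X →ₗ[ℂ] X)).toPMap ⊤).inverse

end Composition

variable {𝓗 𝓚 : Type*} [NormedAddCommGroup 𝓗] [InnerProductSpace ℂ 𝓗] [CompleteSpace 𝓗]
  [NormedAddCommGroup 𝓚] [InnerProductSpace ℂ 𝓚] [CompleteSpace 𝓚]

/-- The perturbation operator `V = F* J F`, on its natural domain. -/
def perturbation (F : 𝓗 →ₗ.[ℂ] 𝓚) (J : 𝓚 →L[ℂ] 𝓚) : 𝓗 →ₗ.[ℂ] 𝓗 :=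
  pcomp F.adjoint ((J : 𝓚 →ₗ[ℂ] 𝓚).compPMap F)

/-- The affine space `𝒜 = A + {F* J F : J ∈ 𝒥}` of operators on `𝓗`. -/
def affineSpace (F : 𝓗 →ₗ.[ℂ] 𝓚) (A : 𝓗 →ₗ.[ℂ] 𝓗) (𝒥 : Submodule ℝ (𝓚 →L[ℂ] 𝓚)) :
    Set (𝓗 →ₗ.[ℂ] 𝓗) :=
  {H | ∃ J ∈ 𝒥, H = A + perturbation F J}

/-- `F R_z(H) F*`, as an operator on its natural domain. -/
def preSandwich (F : 𝓗 →ₗ.[ℂ] 𝓚) (H : 𝓗 →ₗ.[ℂ] 𝓗) (z : ℂ) : 𝓚 →ₗ.[ℂ] 𝓚 :=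
  pcomp F (pcomp (resolventOp H z) F.adjoint)

/-- `T` is a bounded everywhere defined operator which extends `F R_z(H) F*`. When `F*` and
`F R_z(H) F*` are densely defined there is at most one such `T`. -/
def ExtendsSandwich (F : 𝓗 →ₗ.[ℂ] 𝓚) (H : 𝓗 →ₗ.[ℂ] 𝓗) (z : ℂ) (T : 𝓚 →L[ℂ] 𝓚) : Prop :=
  ∀ x : (preSandwich F H z).domain, T x = preSandwich F H z x

open Classical in
/-- The sandwiched resolvent `T_z(H)`: the bounded extension of `F R_z(H) F*` to `𝓚`. -/
def sandwich (F : 𝓗 →ₗ.[ℂ] 𝓚) (H : 𝓗 →ₗ.[ℂ] 𝓗) (z : ℂ) : 𝓚 →L[ℂ] 𝓚 :=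
  if h : ∃ S : 𝓚 →L[ℂ] 𝓚, ExtendsSandwich F H z S then h.choose else 0

/-- The standing assumptions on a rigging operator `F` from `𝓗` to `𝓚`, an operator `A` on `𝓗` and
a real vector space `𝒥` of bounded operators on `𝓚`. -/
structure IsRiggedAffineSpace (F : 𝓗 →ₗ.[ℂ] 𝓚) (A : 𝓗 →ₗ.[ℂ] 𝓗)
    (𝒥 : Submodule ℝ (𝓚 →L[ℂ] 𝓚)) : Prop where
  /-- `F` is a closed operator. -/
  isClosed : F.IsClosed
  /-- `F` has trivial kernel. -/
  ker_eq_bot : LinearMap.ker F.toFun = ⊥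
  /-- `F` has trivial co-kernel, that is, dense range. -/
  denseRange : DenseRange F
  /-- the operators `J` are self-adjoint. -/
  isSelfAdjoint_J : ∀ J ∈ 𝒥, IsSelfAdjoint J
  /-- `𝒜` consists of self-adjoint operators. -/
  isSelfAdjoint : ∀ H ∈ affineSpace F A 𝒥, IsSelfAdjoint H
  /-- The domain of every perturbation `V = F* J F` contains `dom A`; consequently every operator
  `A + V` in `𝒜` has the same domain as `A`. -/
  domain_le_perturbation : ∀ J ∈ 𝒥, A.domain ≤ (perturbation F J).domain
  /-- The domain of `F` contains the common domain of the operators in `𝒜`. -/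
  domain_le : A.domain ≤ F.domain
  /-- The sandwiched resolvents of the operators in `𝒜` are bounded and compact. -/
  compact : ∀ H ∈ affineSpace F A 𝒥, ∀ z : ℂ, z.im ≠ 0 →
    ∃ S : 𝓚 →L[ℂ] 𝓚, ExtendsSandwich F H z S ∧ IsCompactOperator S

/-- `H` is regular at `lam`: the limit of `T_{lam + i y}(H)` as `y → 0⁺` exists in the norm. -/
def IsRegularAt (F : 𝓗 →ₗ.[ℂ] 𝓚) (H : 𝓗 →ₗ.[ℂ] 𝓗) (lam : ℝ) : Prop :=
  ∃ S : 𝓚 →L[ℂ] 𝓚,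
    Tendsto (fun y : ℝ => sandwich F H ((lam : ℂ) + (y : ℂ) * Complex.I)) (𝓝[>] 0) (𝓝 S)

/-- The boundary value `T_{lam + i0}(H)`, for `H` regular at `lam`. -/
def boundaryT (F : 𝓗 →ₗ.[ℂ] 𝓚) (H : 𝓗 →ₗ.[ℂ] 𝓗) (lam : ℝ) : 𝓚 →L[ℂ] 𝓚 :=
  limUnder (𝓝[>] (0 : ℝ)) (fun y : ℝ => sandwich F H ((lam : ℂ) + (y : ℂ) * Complex.I))

/-- `lam` is essentially regular for `(𝒜, F)`: some operator in `𝒜` is regular at `lam`. -/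
def IsEssentiallyRegular (F : 𝓗 →ₗ.[ℂ] 𝓚) (A : 𝓗 →ₗ.[ℂ] 𝓗) (𝒥 : Submodule ℝ (𝓚 →L[ℂ] 𝓚))
    (lam : ℝ) : Prop :=
  ∃ H ∈ affineSpace F A 𝒥, IsRegularAt F H lam

/-- The operator `H₀ + s V` with `V = F* J F` on the line through `H₀` in the direction `V`. -/
def line (F : 𝓗 →ₗ.[ℂ] 𝓚) (H₀ : 𝓗 →ₗ.[ℂ] 𝓗) (J : 𝓚 →L[ℂ] 𝓚) (s : ℝ) : 𝓗 →ₗ.[ℂ] 𝓗 :=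
  H₀ + (s : ℂ) • perturbation F J

/-- `V = F* J F` is a regularizing direction at `lam` for an operator `H` which is resonant at
`lam`: the line through `H` in the direction `V` has a point which is regular at `lam`. -/
def IsRegularizing (F : 𝓗 →ₗ.[ℂ] 𝓚) (H : 𝓗 →ₗ.[ℂ] 𝓗) (lam : ℝ) (J : 𝓚 →L[ℂ] 𝓚) : Prop :=
  ∃ t : ℝ, IsRegularAt F (line F H J t) lam

/-- The space `Υ¹_{lam + i0}(r)` of the line `H_s = H₀ + s V`, `V = F* J F`, written with the help of
a point `s` such that `H_s` is regular at `lam`: the solutions `u` of the homogeneous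
Lippmann–Schwinger equation `(1 + (r - s) T_{lam + i0}(H_s) J) u = 0`. -/
def resonanceVectors (F : 𝓗 →ₗ.[ℂ] 𝓚) (H₀ : 𝓗 →ₗ.[ℂ] 𝓗) (J : 𝓚 →L[ℂ] 𝓚) (lam r s : ℝ) :
    Submodule ℂ 𝓚 :=
  LinearMap.ker ((1 + ((r - s : ℝ) : ℂ) • (boundaryT F (line F H₀ J s) lam ∘L J) :
    𝓚 →L[ℂ] 𝓚) : 𝓚 →ₗ[ℂ] 𝓚)

end SandwichedResolvent

end

/-! Everything follows from the second resolvent identity. Let `H₁`, `H₂` be regular points of the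
two lines through `H`. Then `H₂ = H₁ + F* K F` with `K = (r - s) J + (s' - r') J'`, because both
lines meet at `H`. For nonreal `z` this gives `T_z(H₁) = T_z(H₂) (1 + K T_z(H₁))`, and the identity
passes to the boundary values. If `u = -(r - s) T(H₁) J u`, applying it to `(r - s) J u` cancels the
`J` terms and leaves `u = -(r' - s') T(H₂) J' u`, the other homogeneous equation. Exchanging the
lines gives equality. The identity is carried by `sandwich_resolvent_identity` and its limit
`boundaryT_resolvent_identity`; the cancellation is in `resonanceVectors_le`. -/

namespace SandwichedResolvent

/-! ### Closed and self-adjoint operators -/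

section Operators

variable {X Y : Type*} [NormedAddCommGroup X] [InnerProductSpace ℂ X] [CompleteSpace X]
  [NormedAddCommGroup Y] [InnerProductSpace ℂ Y] [CompleteSpace Y]

/-- The adjoint of a closed operator is densely defined. -/
theorem dense_adjoint_domain {T : X →ₗ.[ℂ] Y} (hT : T.IsClosed) :
    Dense (T.adjoint.domain : Set Y) := by
  rw [Submodule.dense_iff_topologicalClosure_eq_top, Submodule.topologicalClosure_eq_top_iff,
    Submodule.eq_bot_iff]
  intro x hx
  set G : Submodule ℂ (WithLp 2 (X × Y)) :=
    T.graph.comap (WithLp.linearEquiv 2 ℂ (X × Y)).toLinearMap with hG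
  have hGc : IsClosed (G : Set (WithLp 2 (X × Y))) :=
    hT.preimage (WithLp.prod_continuous_ofLp 2 X Y)
  -- Any vector orthogonal to the graph has its second component in the domain of the adjoint, hence
  -- orthogonal to `x`. So `(0, x)` lies in the double complement of a closed graph, which forces `x
  -- = 0`.
  have hmem : WithLp.toLp 2 ((0 : X), x) ∈ G := by
    rw [← hGc.submodule_topologicalClosure_eq, ← Submodule.orthogonal_orthogonal_eq_closure,
      Submodule.mem_orthogonal]
    intro v hv
    rw [Submodule.mem_orthogonal] at hv
    have key : ∀ p : T.domain, inner ℂ (-v.fst) (p : X) = inner ℂ v.snd (T p) := by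
      intro p
      have h := hv (WithLp.toLp 2 ((p : X), T p)) (T.mem_graph p)
      rw [WithLp.prod_inner_apply] at h
      have h' := congrArg (starRingEnd ℂ) h
      simp only [map_add, inner_conj_symm, map_zero] at h'
      rw [inner_neg_left]
      exact neg_eq_of_add_eq_zero_right h'
    have hdom : v.snd ∈ T.adjoint.domain :=
      LinearPMap.mem_adjoint_domain_of_exists _ ⟨_, key⟩
    rw [WithLp.prod_inner_apply]
    simpa using (Submodule.mem_orthogonal _ _).1 hx _ hdom
  exact T.graph_fst_eq_zero_snd hmem rfl

variable {H : X →ₗ.[ℂ] X}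

/-- Symmetry makes `⟨w, H w⟩` real, so only `z` contributes to the imaginary part of `⟨w, (H - z)
w⟩`; Cauchy–Schwarz does the rest. -/
theorem abs_im_mul_norm_le (hH : IsSelfAdjoint H) (z : ℂ) (w : H.domain) :
    |z.im| * ‖(w : X)‖ ≤ ‖H w - z • (w : X)‖ := by
  have hs : inner ℂ (H w) (w : X) = inner ℂ (w : X) (H w) := by
    have h := LinearPMap.adjoint_isFormalAdjoint hH.dense_domain
    rw [LinearPMap.isSelfAdjoint_def.1 hH] at h
    exact h w w
  have him : (inner ℂ (w : X) (H w) : ℂ).im = 0 := by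
    rw [← Complex.conj_eq_iff_im, inner_conj_symm, hs]
  have h1 : (inner ℂ (w : X) (H w - z • (w : X)) : ℂ).im = -(z.im * ‖(w : X)‖ ^ 2) := by
    rw [inner_sub_right, inner_smul_right, inner_self_eq_norm_sq_to_K, Complex.sub_im, him,
      RCLike.ofReal_eq_complex_ofReal, ← Complex.ofReal_pow, Complex.im_mul_ofReal, zero_sub]
  have h2 : |z.im| * ‖(w : X)‖ ^ 2 ≤ ‖(w : X)‖ * ‖H w - z • (w : X)‖ := by
    calc |z.im| * ‖(w : X)‖ ^ 2 = |(inner ℂ (w : X) (H w - z • (w : X)) : ℂ).im| := by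
          rw [h1, abs_neg, abs_mul, abs_of_nonneg (sq_nonneg ‖(w : X)‖)]
      _ ≤ ‖(inner ℂ (w : X) (H w - z • (w : X)) : ℂ)‖ := Complex.abs_im_le_norm _
      _ ≤ _ := norm_inner_le_norm _ _
  rcases (norm_nonneg (w : X)).eq_or_lt with h0 | h0
  · rw [← h0, mul_zero]; exact norm_nonneg _
  · refine le_of_mul_le_mul_left ?_ h0
    linarith

/-- `H - z` is onto for a self-adjoint operator `H` and a nonreal number `z`. -/
theorem exists_apply_sub_smul_eq (hH : IsSelfAdjoint H) {z : ℂ} (hz : z.im ≠ 0) (y : X) :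
    ∃ w : H.domain, H w - z • (w : X) = y := by
  have hcl : IsClosed (H.graph : Set (X × X)) := hH.isClosed
  have : CompleteSpace H.graph := hcl.completeSpace_coe
  -- On the complete space `H.graph`, the operator `H - z` becomes bounded; being bounded below, it
  -- has closed range.
  let f : H.graph →L[ℂ] X :=
    (ContinuousLinearMap.snd ℂ X X - z • ContinuousLinearMap.fst ℂ X X).comp H.graph.subtypeL
  have hf : ∀ w : H.domain, f ⟨((w : X), H w), H.mem_graph w⟩ = H w - z • (w : X) :=
    fun w => rfl
  have hz' : 0 < |z.im| := abs_pos.2 hz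
  have hanti : AntilipschitzWith (Real.toNNReal (|z.im|⁻¹ + (1 + ‖z‖ * |z.im|⁻¹))) f := by
    refine f.antilipschitz_of_bound fun p => ?_
    obtain ⟨⟨a, b⟩, hp⟩ := p
    obtain ⟨w, rfl, rfl⟩ := (LinearPMap.mem_graph_iff H).1 hp
    rw [Real.coe_toNNReal _ (by positivity), hf w]
    have h1 : ‖(w : X)‖ ≤ |z.im|⁻¹ * ‖H w - z • (w : X)‖ := by
      rw [inv_mul_eq_div, le_div_iff₀ hz', mul_comm]
      exact abs_im_mul_norm_le hH z w
    have h2 : ‖H w‖ ≤ (1 + ‖z‖ * |z.im|⁻¹) * ‖H w - z • (w : X)‖ := by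
      calc ‖H w‖ = ‖(H w - z • (w : X)) + z • (w : X)‖ := by rw [sub_add_cancel]
        _ ≤ ‖H w - z • (w : X)‖ + ‖z‖ * ‖(w : X)‖ := by
          rw [← norm_smul]; exact norm_add_le _ _
        _ ≤ ‖H w - z • (w : X)‖ + ‖z‖ * (|z.im|⁻¹ * ‖H w - z • (w : X)‖) := by gcongr
        _ = _ := by ring
    have h3 : ‖(⟨((w : X), H w), hp⟩ : H.graph)‖ = max ‖(w : X)‖ ‖H w‖ := rfl
    rw [h3, add_mul]
    exact max_le (h1.trans (le_add_of_nonneg_right (by positivity)))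
      (h2.trans (le_add_of_nonneg_left (by positivity)))
  have hrc : IsClosed (LinearMap.range (f : H.graph →ₗ[ℂ] X) : Set X) := by
    rw [LinearMap.coe_range]
    exact hanti.isClosed_range f.uniformContinuous
  -- A vector orthogonal to the range is an eigenvector of `H* = H` for the conjugate of `z`, or
  -- zero; the lower bound excludes the former.
  have htop : LinearMap.range (f : H.graph →ₗ[ℂ] X) = ⊤ := by
    rw [← hrc.submodule_topologicalClosure_eq, Submodule.topologicalClosure_eq_top_iff,
      Submodule.eq_bot_iff]
    intro v hv
    rw [Submodule.mem_orthogonal'] at hv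
    have key : ∀ w : H.domain,
        inner ℂ ((starRingEnd ℂ z) • v) (w : X) = inner ℂ v (H w) := by
      intro w
      have h := hv (f ⟨((w : X), H w), H.mem_graph w⟩) ⟨_, rfl⟩
      rw [hf, inner_sub_right, inner_smul_right, sub_eq_zero] at h
      rw [inner_smul_left, Complex.conj_conj, h]
    have hdom : v ∈ H.adjoint.domain := LinearPMap.mem_adjoint_domain_of_exists _ ⟨_, key⟩
    have hval := LinearPMap.adjoint_apply_eq hH.dense_domain ⟨v, hdom⟩ key
    have hgr : (v, (starRingEnd ℂ z) • v) ∈ H.adjoint.graph :=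
      (LinearPMap.mem_graph_iff _).2 ⟨⟨v, hdom⟩, rfl, hval⟩
    rw [LinearPMap.isSelfAdjoint_def.1 hH] at hgr
    obtain ⟨w, hw, hw'⟩ := (LinearPMap.mem_graph_iff _).1 hgr
    dsimp only at hw hw'
    have hb := abs_im_mul_norm_le hH (starRingEnd ℂ z) w
    rw [hw', hw, sub_self, norm_zero, Complex.conj_im, abs_neg] at hb
    exact norm_le_zero_iff.1 (nonpos_of_mul_nonpos_right hb hz')
  obtain ⟨⟨⟨a, b⟩, hp⟩, hy⟩ := htop.ge (Submodule.mem_top : y ∈ ⊤)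
  obtain ⟨w, rfl, rfl⟩ := (LinearPMap.mem_graph_iff H).1 hp
  exact ⟨w, hy⟩

/-- `(H - z)⁻¹` maps `(H - z) w` to `w`. -/
theorem mem_resolventOp_graph (hH : IsSelfAdjoint H) {z : ℂ} (hz : z.im ≠ 0) (w : H.domain) :
    (H w - z • (w : X), (w : X)) ∈ (resolventOp H z).graph := by
  have hker : (H - (z • (LinearMap.id : X →ₗ[ℂ] X)).toPMap ⊤).toFun.ker = ⊥ := by
    rw [LinearMap.ker_eq_bot']
    intro m hm
    have hb := abs_im_mul_norm_le hH z ⟨m, m.2.1⟩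
    have hm' : H ⟨m, m.2.1⟩ - z • (m : X) = 0 := hm
    rw [hm', norm_zero] at hb
    exact Subtype.ext (norm_le_zero_iff.1 (nonpos_of_mul_nonpos_right hb (abs_pos.2 hz)))
  exact LinearPMap.mem_inverse_graph hker ⟨w, w.2, Submodule.mem_top⟩

end Operators

/-! ### Graph calculus for partially defined operators -/

section Composition

variable {X Y Z : Type*} [AddCommGroup X] [Module ℂ X] [AddCommGroup Y] [Module ℂ Y]
  [AddCommGroup Z] [Module ℂ Z]

theorem mem_pcomp_graph {g : Y →ₗ.[ℂ] Z} {f : X →ₗ.[ℂ] Y} {x : X} {z : Z} :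
    (x, z) ∈ (pcomp g f).graph ↔ ∃ y, (x, y) ∈ f.graph ∧ (y, z) ∈ g.graph := by
  constructor
  · intro h
    obtain ⟨⟨a, ha⟩, rfl, rfl⟩ := (LinearPMap.mem_graph_iff _).1 h
    obtain ⟨h1, h2⟩ := (mem_pcomp_domain g f a).1 ha
    exact ⟨f ⟨a, h1⟩, f.mem_graph ⟨a, h1⟩, g.mem_graph ⟨_, h2⟩⟩
  · rintro ⟨y, hy, hz⟩
    obtain ⟨⟨a, ha⟩, rfl, rfl⟩ := (LinearPMap.mem_graph_iff _).1 hy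
    obtain ⟨⟨b, hb⟩, hab, rfl⟩ := (LinearPMap.mem_graph_iff _).1 hz
    dsimp only at hab
    subst hab
    exact (pcomp g f).mem_graph ⟨a, (mem_pcomp_domain g f a).2 ⟨ha, hb⟩⟩

theorem mem_add_graph {f g : X →ₗ.[ℂ] X} {x a b : X} (ha : (x, a) ∈ f.graph)
    (hb : (x, b) ∈ g.graph) : (x, a + b) ∈ (f + g).graph := by
  obtain ⟨⟨u, hu⟩, rfl, rfl⟩ := (LinearPMap.mem_graph_iff _).1 ha
  obtain ⟨⟨v, hv⟩, huv, rfl⟩ := (LinearPMap.mem_graph_iff _).1 hb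
  dsimp only at huv
  subst huv
  exact (f + g).mem_graph ⟨v, hu, hv⟩

theorem mem_smul_graph {f : X →ₗ.[ℂ] X} {x a : X} (c : ℂ) (ha : (x, a) ∈ f.graph) :
    (x, c • a) ∈ (c • f).graph := by
  obtain ⟨u, rfl, rfl⟩ := (LinearPMap.mem_graph_iff _).1 ha
  exact (c • f).mem_graph u

end Composition

variable {𝓗 𝓚 : Type*} [NormedAddCommGroup 𝓗] [InnerProductSpace ℂ 𝓗] [CompleteSpace 𝓗]
  [NormedAddCommGroup 𝓚] [InnerProductSpace ℂ 𝓚] [CompleteSpace 𝓚]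
  {F : 𝓗 →ₗ.[ℂ] 𝓚} {A : 𝓗 →ₗ.[ℂ] 𝓗} {𝒥 : Submodule ℝ (𝓚 →L[ℂ] 𝓚)}

theorem mem_perturbation_graph {J : 𝓚 →L[ℂ] 𝓚} {w v : 𝓗} :
    (w, v) ∈ (perturbation F J).graph ↔
      ∃ k, (w, k) ∈ F.graph ∧ (J k, v) ∈ F.adjoint.graph := by
  have h : ∀ k, (w, k) ∈ ((J : 𝓚 →ₗ[ℂ] 𝓚).compPMap F).graph ↔
      ∃ l, (w, l) ∈ F.graph ∧ J l = k := by
    intro k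
    constructor
    · intro h
      obtain ⟨a, rfl, rfl⟩ := (LinearPMap.mem_graph_iff _).1 h
      exact ⟨F a, F.mem_graph a, rfl⟩
    · rintro ⟨l, hl, rfl⟩
      obtain ⟨a, rfl, rfl⟩ := (LinearPMap.mem_graph_iff _).1 hl
      exact ((J : 𝓚 →ₗ[ℂ] 𝓚).compPMap F).mem_graph a
  rw [perturbation, mem_pcomp_graph]
  constructor
  · rintro ⟨y, hy, hv⟩
    obtain ⟨l, hl, rfl⟩ := (h y).1 hy
    exact ⟨l, hl, hv⟩
  · rintro ⟨l, hl, hv⟩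
    exact ⟨J l, (h _).2 ⟨l, hl, rfl⟩, hv⟩

theorem mem_perturbation_graph_add {J J' : 𝓚 →L[ℂ] 𝓚} {w v v' : 𝓗}
    (h : (w, v) ∈ (perturbation F J).graph) (h' : (w, v') ∈ (perturbation F J').graph) :
    (w, v + v') ∈ (perturbation F (J + J')).graph := by
  obtain ⟨k, hk, hv⟩ := mem_perturbation_graph.1 h
  obtain ⟨k', hk', hv'⟩ := mem_perturbation_graph.1 h'
  obtain rfl : k = k' := LinearPMap.mem_graph_snd_inj _ hk hk' rfl
  exact mem_perturbation_graph.2 ⟨k, hk, F.adjoint.graph.add_mem hv hv'⟩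

theorem mem_perturbation_graph_smul {J : 𝓚 →L[ℂ] 𝓚} {w v : 𝓗} (c : ℝ)
    (h : (w, v) ∈ (perturbation F J).graph) :
    (w, (c : ℂ) • v) ∈ (perturbation F (c • J)).graph := by
  obtain ⟨k, hk, hv⟩ := mem_perturbation_graph.1 h
  refine mem_perturbation_graph.2 ⟨k, hk, ?_⟩
  simpa [Complex.coe_smul] using F.adjoint.graph.smul_mem (c : ℂ) hv

theorem mem_line_graph {H₀ : 𝓗 →ₗ.[ℂ] 𝓗} {J : 𝓚 →L[ℂ] 𝓚} (s : ℝ)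
    {w a v : 𝓗} (ha : (w, a) ∈ H₀.graph) (hv : (w, v) ∈ (perturbation F J).graph) :
    (w, a + (s : ℂ) • v) ∈ (line F H₀ J s).graph :=
  mem_add_graph ha (mem_smul_graph _ hv)

/-! ### Resolvent identities and resonance vectors -/

namespace IsRiggedAffineSpace

variable (hA : IsRiggedAffineSpace F A 𝒥)
include hA

theorem domain_eq {H : 𝓗 →ₗ.[ℂ] 𝓗} (hH : H ∈ affineSpace F A 𝒥) : H.domain = A.domain := by
  obtain ⟨J, hJ, rfl⟩ := hH
  exact inf_eq_left.2 (hA.domain_le_perturbation J hJ)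

theorem dense_adjoint_domain : Dense (F.adjoint.domain : Set 𝓚) :=
  SandwichedResolvent.dense_adjoint_domain hA.isClosed

theorem exists_mem_perturbation_graph {J : 𝓚 →L[ℂ] 𝓚} (hJ : J ∈ 𝒥) {w : 𝓗}
    (hw : w ∈ A.domain) : ∃ v, (w, v) ∈ (perturbation F J).graph :=
  LinearPMap.mem_domain_iff.1 (hA.domain_le_perturbation J hJ hw)

/-- Lines in the directions `F* J F`, `J ∈ 𝒥`, stay in the affine space. -/
theorem line_mem {H₀ : 𝓗 →ₗ.[ℂ] 𝓗} (hH₀ : H₀ ∈ affineSpace F A 𝒥) {J : 𝓚 →L[ℂ] 𝓚}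
    (hJ : J ∈ 𝒥) (s : ℝ) : line F H₀ J s ∈ affineSpace F A 𝒥 := by
  obtain ⟨J₀, hJ₀, rfl⟩ := hH₀
  have hJs : J₀ + s • J ∈ 𝒥 := 𝒥.add_mem hJ₀ (𝒥.smul_mem s hJ)
  refine ⟨J₀ + s • J, hJs, ?_⟩
  have hdom : (line F (A + perturbation F J₀) J s).domain = A.domain := by
    change (A.domain ⊓ (perturbation F J₀).domain) ⊓ (perturbation F J).domain = A.domain
    rw [inf_eq_left.2 (hA.domain_le_perturbation J₀ hJ₀),
      inf_eq_left.2 (hA.domain_le_perturbation J hJ)]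
  -- `F* (J₀ + s J) F` may have a larger domain than the sum of the perturbations; adding `A` cuts
  -- both sides down to `A.domain`, so inclusion of graphs suffices.
  refine LinearPMap.eq_of_le_of_domain_eq (LinearPMap.le_of_le_graph ?_)
    (hdom.trans (hA.domain_eq ⟨_, hJs, rfl⟩).symm)
  rintro ⟨w, y⟩ hy
  have hw : w ∈ A.domain := hdom ▸ LinearPMap.mem_domain_iff.2 ⟨y, hy⟩
  obtain ⟨a, ha⟩ := LinearPMap.mem_domain_iff.1 hw
  obtain ⟨v₀, hv₀⟩ := hA.exists_mem_perturbation_graph hJ₀ hw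
  obtain ⟨v, hv⟩ := hA.exists_mem_perturbation_graph hJ hw
  obtain rfl : y = a + v₀ + (s : ℂ) • v :=
    LinearPMap.mem_graph_snd_inj _ hy (mem_line_graph s (mem_add_graph ha hv₀) hv) rfl
  rw [add_assoc]
  exact mem_add_graph ha
    (mem_perturbation_graph_add hv₀ (mem_perturbation_graph_smul s hv))

/-- If `w = (H - z)⁻¹ F* x` then `T_z(H) x = F w`. -/
theorem sandwich_apply {H : 𝓗 →ₗ.[ℂ] 𝓗} (hH : H ∈ affineSpace F A 𝒥) {z : ℂ} (hz : z.im ≠ 0)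
    {w a : 𝓗} {x k : 𝓚} (ha : (w, a) ∈ H.graph) (hx : (x, a - z • w) ∈ F.adjoint.graph)
    (hk : (w, k) ∈ F.graph) : sandwich F H z x = k := by
  have hex : ∃ S : 𝓚 →L[ℂ] 𝓚, ExtendsSandwich F H z S := by
    obtain ⟨S, hS, -⟩ := hA.compact H hH z hz
    exact ⟨S, hS⟩
  have hspec : ExtendsSandwich F H z (sandwich F H z) := by
    rw [sandwich, dif_pos hex]
    exact hex.choose_spec
  have hres : (a - z • w, w) ∈ (resolventOp H z).graph := by
    obtain ⟨w, rfl, rfl⟩ := (LinearPMap.mem_graph_iff _).1 ha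
    exact mem_resolventOp_graph (hA.isSelfAdjoint H hH) hz w
  have hgr : (x, k) ∈ (preSandwich F H z).graph :=
    mem_pcomp_graph.2 ⟨w, mem_pcomp_graph.2 ⟨_, hx, hres⟩, hk⟩
  obtain ⟨u, rfl, rfl⟩ := (LinearPMap.mem_graph_iff _).1 hgr
  exact hspec u

/-- The second resolvent identity `T_z(H₁) = T_z(H₂) (1 + K T_z(H₁))` for `H₂ = H₁ + F* K F`. -/
theorem sandwich_resolvent_identity {H₁ H₂ : 𝓗 →ₗ.[ℂ] 𝓗} (h₁ : H₁ ∈ affineSpace F A 𝒥)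
    (h₂ : H₂ ∈ affineSpace F A 𝒥) {K : 𝓚 →L[ℂ] 𝓚}
    (hK : ∀ w ∈ A.domain, ∃ a v, (w, a) ∈ H₁.graph ∧ (w, v) ∈ (perturbation F K).graph ∧
      (w, a + v) ∈ H₂.graph) {z : ℂ} (hz : z.im ≠ 0) :
    sandwich F H₁ z = sandwich F H₂ z ∘L (1 + K ∘L sandwich F H₁ z) := by
  refine ContinuousLinearMap.ext fun x => ?_
  refine congrFun (Continuous.ext_on hA.dense_adjoint_domain
    (sandwich F H₁ z).continuous (ContinuousLinearMap.continuous _) ?_) x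
  intro x hx
  obtain ⟨y, hy⟩ := LinearPMap.mem_domain_iff.1 hx
  obtain ⟨w, rfl⟩ := exists_apply_sub_smul_eq (hA.isSelfAdjoint H₁ h₁) hz y
  obtain ⟨a, v, ha, hv, hav⟩ := hK w (hA.domain_eq h₁ ▸ w.2)
  obtain rfl : a = H₁ w := LinearPMap.mem_graph_snd_inj _ ha (H₁.mem_graph w) rfl
  obtain ⟨k, hk, hkv⟩ := mem_perturbation_graph.1 hv
  have e₁ : sandwich F H₁ z x = k := hA.sandwich_apply h₁ hz ha hy hk
  -- With `w = (H₁ - z)⁻¹ F* x` and `k = F w`, one has `(H₂ - z) w = F* x + F* K F w = F* (x + K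
  -- k)`.
  have e₂ : sandwich F H₂ z (x + K k) = k := by
    refine hA.sandwich_apply h₂ hz hav ?_ hk
    rw [add_sub_right_comm]
    exact F.adjoint.graph.add_mem hy hkv
  change sandwich F H₁ z x = sandwich F H₂ z (x + K (sandwich F H₁ z x))
  rw [e₁, e₂]

theorem boundaryT_resolvent_identity {H₁ H₂ : 𝓗 →ₗ.[ℂ] 𝓗} (h₁ : H₁ ∈ affineSpace F A 𝒥)
    (h₂ : H₂ ∈ affineSpace F A 𝒥) {K : 𝓚 →L[ℂ] 𝓚}
    (hK : ∀ w ∈ A.domain, ∃ a v, (w, a) ∈ H₁.graph ∧ (w, v) ∈ (perturbation F K).graph ∧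
      (w, a + v) ∈ H₂.graph) {lam : ℝ} (hr₁ : IsRegularAt F H₁ lam)
    (hr₂ : IsRegularAt F H₂ lam) :
    boundaryT F H₁ lam = boundaryT F H₂ lam ∘L (1 + K ∘L boundaryT F H₁ lam) := by
  have l₁ := tendsto_nhds_limUnder hr₁
  have l₂ := tendsto_nhds_limUnder hr₂
  refine tendsto_nhds_unique_of_eventuallyEq l₁
    (l₂.mul (tendsto_const_nhds.add (tendsto_const_nhds.mul l₁))) ?_
  filter_upwards [self_mem_nhdsWithin] with y hy
  refine hA.sandwich_resolvent_identity h₁ h₂ hK ?_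
  simpa using (ne_of_gt hy : y ≠ 0)

theorem resonanceVectors_le {H₀ H₀' : 𝓗 →ₗ.[ℂ] 𝓗} (hH₀ : H₀ ∈ affineSpace F A 𝒥)
    (hH₀' : H₀' ∈ affineSpace F A 𝒥) {J J' : 𝓚 →L[ℂ] 𝓚} (hJ : J ∈ 𝒥) (hJ' : J' ∈ 𝒥)
    {r r' s s' lam : ℝ} (hr : line F H₀ J r = line F H₀' J' r')
    (hs : IsRegularAt F (line F H₀ J s) lam) (hs' : IsRegularAt F (line F H₀' J' s') lam) :
    resonanceVectors F H₀ J lam r s ≤ resonanceVectors F H₀' J' lam r' s' := by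
  have hid := hA.boundaryT_resolvent_identity (hA.line_mem hH₀ hJ s) (hA.line_mem hH₀' hJ' s')
    -- The path runs from `s` to the common point `H` along the first line, then from `H` to `s'`
    -- along the second.
    (K := (r - s) • J + (s' - r') • J') (fun w hw => ?_) hs hs'
  · intro u hu
    set T := boundaryT F (line F H₀ J s) lam
    set T' := boundaryT F (line F H₀' J' s') lam
    have hu' : u + (r - s) • T (J u) = 0 := by
      simpa [resonanceVectors, T, ← Complex.ofReal_sub, Complex.coe_smul] using hu
    suffices h : u + (r' - s') • T' (J' u) = 0 by
      simpa [resonanceVectors, T', ← Complex.ofReal_sub, Complex.coe_smul] using h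
    have hTu : (r - s) • T (J u) = -u := (neg_eq_of_add_eq_zero_right hu').symm
    have h : T ((r - s) • J u) = T' ((r - s) • J u +
        ((r - s) • J (T ((r - s) • J u)) + (s' - r') • J' (T ((r - s) • J u)))) :=
      DFunLike.congr_fun hid ((r - s) • J u)
    have hTx : T ((r - s) • J u) = -u := by
      rw [← hTu]; exact T.map_smul_of_tower (r - s) (J u)
    -- The argument of `T'` after substituting `-u` for `T ((r - s) • J u)`: the `J` terms cancel.
    have hx : (r - s) • J u + ((r - s) • J (-u) + (s' - r') • J' (-u)) =
        (r' - s') • J' u := by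
      rw [map_neg, map_neg]; module
    rw [hTx, hx, ContinuousLinearMap.map_smul_of_tower] at h
    rw [← h, add_neg_cancel]
  · obtain ⟨a, ha⟩ := LinearPMap.mem_domain_iff.1 (hA.domain_eq hH₀ ▸ hw : w ∈ H₀.domain)
    obtain ⟨a', ha'⟩ := LinearPMap.mem_domain_iff.1 (hA.domain_eq hH₀' ▸ hw : w ∈ H₀'.domain)
    obtain ⟨v, hv⟩ := hA.exists_mem_perturbation_graph hJ hw
    obtain ⟨v', hv'⟩ := hA.exists_mem_perturbation_graph hJ' hw
    have e : a + (r : ℂ) • v = a' + (r' : ℂ) • v' :=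
      LinearPMap.mem_graph_snd_inj _ (mem_line_graph r ha hv)
        (hr ▸ mem_line_graph r' ha' hv') rfl
    refine ⟨_, _, mem_line_graph s ha hv, mem_perturbation_graph_add
      (mem_perturbation_graph_smul _ hv) (mem_perturbation_graph_smul _ hv'), ?_⟩
    have e' : a + (s : ℂ) • v + (((r - s : ℝ) : ℂ) • v + ((s' - r' : ℝ) : ℂ) • v') =
        a' + (s' : ℂ) • v' := by
      rw [← sub_eq_zero] at e ⊢
      rw [← e]
      push_cast
      module
    rw [e']
    exact mem_line_graph s' ha' hv'

end IsRiggedAffineSpace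

end SandwichedResolvent

theorem theoremT {𝓗 𝓚 : Type*}
    [NormedAddCommGroup 𝓗] [InnerProductSpace ℂ 𝓗] [CompleteSpace 𝓗]
    [TopologicalSpace.SeparableSpace 𝓗]
    [NormedAddCommGroup 𝓚] [InnerProductSpace ℂ 𝓚] [CompleteSpace 𝓚]
    [TopologicalSpace.SeparableSpace 𝓚]
    (F : 𝓗 →ₗ.[ℂ] 𝓚) (A : 𝓗 →ₗ.[ℂ] 𝓗) (𝒥 : Submodule ℝ (𝓚 →L[ℂ] 𝓚))
    (hA : SandwichedResolvent.IsRiggedAffineSpace F A 𝒥)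
    (lam : ℝ) (hlam : SandwichedResolvent.IsEssentiallyRegular F A 𝒥 lam)
    (H : 𝓗 →ₗ.[ℂ] 𝓗) (hH : H ∈ SandwichedResolvent.affineSpace F A 𝒥)
    (hres : ¬ SandwichedResolvent.IsRegularAt F H lam)
    (J : 𝓚 →L[ℂ] 𝓚) (hJ : J ∈ 𝒥) (hJreg : SandwichedResolvent.IsRegularizing F H lam J)
    (J' : 𝓚 →L[ℂ] 𝓚) (hJ' : J' ∈ 𝒥) (hJreg' : SandwichedResolvent.IsRegularizing F H lam J')
    (H₀ : 𝓗 →ₗ.[ℂ] 𝓗) (hH₀ : H₀ ∈ SandwichedResolvent.affineSpace F A 𝒥)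
    (r : ℝ) (hr : SandwichedResolvent.line F H₀ J r = H)
    (H₀' : 𝓗 →ₗ.[ℂ] 𝓗) (hH₀' : H₀' ∈ SandwichedResolvent.affineSpace F A 𝒥)
    (r' : ℝ) (hr' : SandwichedResolvent.line F H₀' J' r' = H)
    (s : ℝ) (hs : SandwichedResolvent.IsRegularAt F (SandwichedResolvent.line F H₀ J s) lam)
    (s' : ℝ) (hs' : SandwichedResolvent.IsRegularAt F (SandwichedResolvent.line F H₀' J' s') lam) :
    SandwichedResolvent.resonanceVectors F H₀ J lam r s =
      SandwichedResolvent.resonanceVectors F H₀' J' lam r' s' := by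
  subst hr
  exact le_antisymm (hA.resonanceVectors_le hH₀ hH₀' hJ hJ' hr'.symm hs hs')
    (hA.resonanceVectors_le hH₀' hH₀ hJ' hJ hr' hs' hs)
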